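/- Let $R$ be an integral domain with quotient field $K$. For a nonzero fractional ideal $I$ of $R$ put $I^{-1}=\{x\in K : xI\subseteq R\}$, $I^v=(I^{-1})^{-1}$ and $I^t=\bigcup J^v$, where $J$ ranges over the nonzero finitely generated fractional ideals contained in $I$. A $t$-ideal is a nonzero ideal $I$ of $R$ with $I^t=I$; a maximal $t$-ideal is a $t$-ideal that is maximal among the proper $t$-ideals; a nonzero ideal $I$ is $t$-invertible if $(II^{-1})^t=R$. A nonzero finitely generated ideal $I$ of $R$ is $t$-rigid if it is contained in exactly one maximal $t$-ideal of $R$, and $t$-super rigid if, in addition, every finitely generated ideal $J\supseteq I$ of $R$ is $t$-invertible. The domain $R$ is $t$-potent (resp. $t$-super potent) if each maximal $t$-ideal of $R$ contains a $t$-rigid (resp. $t$-super rigid) ideal. **Theorem 3.2.** Let $R$ be an integral domain. Then $R$ is $t$-potent if and only if the polynomial ring $R[X]$ is $t$-potent, and $R$ is $t$-super potent if and only if $R[X]$ is $t$-super potent. -/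

import Mathlib

open scoped nonZeroDivisors

namespace TOperation

/-- The `v`-operation `I ↦ (I⁻¹)⁻¹` on fractional ideals, where
`I⁻¹ = {x ∈ K | x I ⊆ R}` for `I ≠ 0` (and `0⁻¹ = 0`, so that the value at `0` is `0`). -/
noncomputable def vClosure {R K : Type*} [CommRing R] [IsDomain R] [Field K] [Algebra R K]
    [IsFractionRing R K] (I : FractionalIdeal R⁰ K) : FractionalIdeal R⁰ K :=
  I⁻¹⁻¹

theorem vClosure_zero {R K : Type*} [CommRing R] [IsDomain R] [Field K] [Algebra R K]
    [IsFractionRing R K] : vClosure (0 : FractionalIdeal R⁰ K) = 0 := by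
  rw [vClosure, FractionalIdeal.inv_zero', FractionalIdeal.inv_zero']

theorem vClosure_mono {R K : Type*} [CommRing R] [IsDomain R] [Field K] [Algebra R K]
    [IsFractionRing R K] {I J : FractionalIdeal R⁰ K} (h : I ≤ J) :
    vClosure I ≤ vClosure J := by
  by_cases hI : I = 0
  · rw [hI, vClosure_zero]; exact bot_le
  · have hJ : J ≠ 0 := by
      rintro rfl
      exact hI (le_antisymm h bot_le)
    have inv_ne : ∀ A : FractionalIdeal R⁰ K, A ≠ 0 → A⁻¹ ≠ 0 := by
      intro A hA h0
      obtain ⟨a, ha, hle⟩ := A.isFractional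
      have ha0 : algebraMap R K a ≠ 0 := by
        simpa using nonZeroDivisors.ne_zero ha
      have hm : algebraMap R K a ∈ A⁻¹ := by
        rw [FractionalIdeal.mem_inv_iff hA]
        intro y hy
        obtain ⟨r, hr⟩ := hle y hy
        rw [FractionalIdeal.mem_one_iff]
        exact ⟨r, by rw [hr, Algebra.smul_def]⟩
      rw [h0, FractionalIdeal.mem_zero_iff] at hm
      exact ha0 hm
    exact FractionalIdeal.inv_anti_mono (inv_ne J hJ) (inv_ne I hI)
      (FractionalIdeal.inv_anti_mono hI hJ h)

/-- The `t`-operation: `I^t` is the union of the `J^v` over all finitely generated fractional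
ideals `J ⊆ I`. (The summand `J = 0` contributes only the element `0`.) -/
noncomputable def tClosure {R K : Type*} [CommRing R] [IsDomain R] [Field K] [Algebra R K]
    [IsFractionRing R K] (I : FractionalIdeal R⁰ K) : FractionalIdeal R⁰ K :=
  ⟨{ carrier := {x | ∃ J : FractionalIdeal R⁰ K,
        (J : Submodule R K).FG ∧ J ≤ I ∧ x ∈ vClosure J}
     zero_mem' := ⟨0, by simpa using Submodule.fg_bot, bot_le, Submodule.zero_mem _⟩
     add_mem' := by
       rintro x y ⟨J, hJ, hJI, hx⟩ ⟨L, hL, hLI, hy⟩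
       refine ⟨J ⊔ L, ?_, sup_le hJI hLI, ?_⟩
       · rw [FractionalIdeal.coe_sup]
         exact hJ.sup hL
       · exact Submodule.add_mem _ (vClosure_mono le_sup_left hx)
           (vClosure_mono le_sup_right hy)
     smul_mem' := by
       rintro c x ⟨J, hJ, hJI, hx⟩
       exact ⟨J, hJ, hJI, Submodule.smul_mem _ c hx⟩ },
   by
    obtain ⟨a, ha, h⟩ := (vClosure I).isFractional
    refine ⟨a, ha, ?_⟩
    rintro x ⟨J, _, hJI, hx⟩
    exact h x (vClosure_mono hJI hx)⟩

theorem mem_tClosure {R K : Type*} [CommRing R] [IsDomain R] [Field K] [Algebra R K]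
    [IsFractionRing R K] {I : FractionalIdeal R⁰ K} {x : K} :
    x ∈ tClosure I ↔ ∃ J : FractionalIdeal R⁰ K,
      (J : Submodule R K).FG ∧ J ≤ I ∧ x ∈ vClosure J :=
  Iff.rfl

/-- A (nonzero, integral) `t`-ideal: `I ≠ 0` and `I^t = I`. -/
def IsTIdeal {R : Type*} [CommRing R] [IsDomain R] (I : Ideal R) : Prop :=
  I ≠ ⊥ ∧ tClosure (I : FractionalIdeal R⁰ (FractionRing R)) = I

/-- A maximal `t`-ideal: an ideal that is maximal among the proper `t`-ideals. -/
def IsMaximalTIdeal {R : Type*} [CommRing R] [IsDomain R] (M : Ideal R) : Prop :=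
  Maximal (fun I : Ideal R => IsTIdeal I ∧ I ≠ ⊤) M

/-- A nonzero ideal `I` is `t`-invertible if `(I I⁻¹)^t = R`. -/
def IsTInvertible {R : Type*} [CommRing R] [IsDomain R] (I : Ideal R) : Prop :=
  I ≠ ⊥ ∧ tClosure ((I : FractionalIdeal R⁰ (FractionRing R)) *
    (I : FractionalIdeal R⁰ (FractionRing R))⁻¹) = 1

/-- A `t`-rigid ideal: nonzero, finitely generated, and contained in exactly one maximal
`t`-ideal. -/
def IsTRigid {R : Type*} [CommRing R] [IsDomain R] (I : Ideal R) : Prop :=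
  I ≠ ⊥ ∧ I.FG ∧ ∃! M : Ideal R, IsMaximalTIdeal M ∧ I ≤ M

/-- A `t`-super rigid ideal: a `t`-rigid ideal such that every finitely generated ideal
containing it is `t`-invertible. -/
def IsTSuperRigid {R : Type*} [CommRing R] [IsDomain R] (I : Ideal R) : Prop :=
  IsTRigid I ∧ ∀ J : Ideal R, J.FG → I ≤ J → IsTInvertible J

/-- A domain is `t`-potent if each of its maximal `t`-ideals contains a `t`-rigid ideal. -/
def IsTPotent (R : Type*) [CommRing R] [IsDomain R] : Prop :=
  ∀ M : Ideal R, IsMaximalTIdeal M → ∃ I : Ideal R, IsTRigid I ∧ I ≤ M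

/-- A domain is `t`-super potent if each of its maximal `t`-ideals contains a `t`-super rigid
ideal. -/
def IsTSuperPotent (R : Type*) [CommRing R] [IsDomain R] : Prop :=
  ∀ M : Ideal R, IsMaximalTIdeal M → ∃ I : Ideal R, IsTSuperRigid I ∧ I ≤ M

end TOperation

/-! Maximal `t`-ideals of `R[X]` are of two kinds (`IsMaximalTIdeal.exists_eq_map_C_or`): extensions
`M[X]` of maximal `t`-ideals `M` of `R`, and ideals containing some `g` whose content has divisorial
closure `R`. Every `M[X]` does occur (`IsMaximalTIdeal.map_C`). An ideal `Q` of the second kind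
needs no hypothesis on `R`: if `f` has minimal degree in `Q`, then `(f, g)` is already `t`-super
rigid (`IsMaximalTIdeal.exists_isTSuperRigid`). For the first kind, rigidity moves along the Galois
connection between `coeffIdeal` and `I ↦ I[X]` (`coeffIdeal_le_iff`). Super rigidity moves as well,
because `t`-invertibility can be tested one maximal `t`-ideal at a time (`isTInvertible_iff`) and
these local conditions pass between `R` and `R[X]`. -/

namespace TOperation

open Polynomial

/-! ### Divisorial and `t`-closure without fractions -/

section Divisorial

variable {R : Type*} [CommRing R]

/-- The divisorial closure of an ideal of a domain, described inside the domain: `x` belongs to it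
if every fraction `a / b` which multiplies `J` into the domain also multiplies `x` into it. -/
def divClosure (J : Ideal R) : Ideal R where
  carrier := {x | ∀ a b : R, (∀ j ∈ J, b ∣ a * j) → b ∣ a * x}
  zero_mem' := fun a b _ => by simp
  add_mem' := fun hx hy a b h => by
    rw [mul_add]
    exact dvd_add (hx a b h) (hy a b h)
  smul_mem' := fun c x hx a b h => by
    rw [smul_eq_mul, mul_left_comm]
    exact (hx a b h).mul_left c

theorem le_divClosure (J : Ideal R) : J ≤ divClosure J :=
  fun _ hx _ _ h => h _ hx

theorem divClosure_mono {I J : Ideal R} (h : I ≤ J) : divClosure I ≤ divClosure J :=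
  fun _ hx a b hJ => hx a b fun j hj => hJ j (h hj)

theorem divClosure_divClosure (J : Ideal R) : divClosure (divClosure J) = divClosure J :=
  le_antisymm (fun _ hx a b h => hx a b fun _ hj => hj a b h) (le_divClosure _)

/-- The union of the divisorial closures of the finitely generated subideals. -/
def tIdealClosure (I : Ideal R) : Ideal R where
  carrier := {x | ∃ J : Ideal R, J.FG ∧ J ≤ I ∧ x ∈ divClosure J}
  zero_mem' := ⟨⊥, Submodule.fg_bot, bot_le, zero_mem _⟩
  add_mem' := by
    rintro x y ⟨J, hJ, hJI, hx⟩ ⟨L, hL, hLI, hy⟩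
    exact ⟨J ⊔ L, Submodule.FG.sup hJ hL, sup_le hJI hLI,
      add_mem (divClosure_mono le_sup_left hx) (divClosure_mono le_sup_right hy)⟩
  smul_mem' := by
    rintro c x ⟨J, hJ, hJI, hx⟩
    exact ⟨J, hJ, hJI, Submodule.smul_mem _ c hx⟩

theorem le_tIdealClosure (I : Ideal R) : I ≤ tIdealClosure I := fun x hx =>
  ⟨Ideal.span {x}, Submodule.fg_span_singleton x, (Ideal.span_singleton_le_iff_mem I).2 hx,
    le_divClosure _ (Ideal.mem_span_singleton_self x)⟩

theorem exists_fg_le_divClosure {I J : Ideal R} (hJ : J.FG) (h : J ≤ tIdealClosure I) :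
    ∃ L : Ideal R, L.FG ∧ L ≤ I ∧ J ≤ divClosure L := by
  classical
  obtain ⟨s, rfl⟩ := hJ
  induction s using Finset.induction_on with
  | empty => exact ⟨⊥, Submodule.fg_bot, bot_le, by simp⟩
  | insert a s _ ih =>
    rw [Finset.coe_insert, Ideal.span_insert] at h ⊢
    obtain ⟨L, hL, hLI, hle⟩ := ih (le_sup_right.trans h)
    obtain ⟨N, hN, hNI, ha⟩ := h (le_sup_left (a := Ideal.span {a})
      (Ideal.mem_span_singleton_self a))
    exact ⟨N ⊔ L, Submodule.FG.sup hN hL, sup_le hNI hLI, sup_le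
      ((Ideal.span_singleton_le_iff_mem _).2 (divClosure_mono le_sup_left ha))
      (hle.trans (divClosure_mono le_sup_right))⟩

end Divisorial

/-! ### Comparison with fractional ideals, maximal `t`-ideals, `t`-invertibility -/

section Domain

variable {R : Type*} [CommRing R] [IsDomain R]

theorem div_mem_inv_coeIdeal_iff {J : Ideal R} (hJ : J ≠ ⊥) {a b : R} (hb : b ≠ 0) :
    algebraMap R (FractionRing R) a / algebraMap R (FractionRing R) b ∈
      (J : FractionalIdeal R⁰ (FractionRing R))⁻¹ ↔ ∀ j ∈ J, b ∣ a * j := by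
  have hb' : algebraMap R (FractionRing R) b ≠ 0 := by simpa using hb
  rw [FractionalIdeal.mem_inv_iff (FractionalIdeal.coeIdeal_ne_zero.2 hJ)]
  have key : ∀ j : R, algebraMap R (FractionRing R) a / algebraMap R (FractionRing R) b *
      algebraMap R (FractionRing R) j ∈ (1 : FractionalIdeal R⁰ (FractionRing R)) ↔ b ∣ a * j := by
    intro j
    rw [FractionalIdeal.mem_one_iff]
    refine exists_congr fun c => ?_
    rw [div_mul_eq_mul_div, eq_div_iff hb', ← map_mul, ← map_mul,
      (FaithfulSMul.algebraMap_injective R (FractionRing R)).eq_iff, mul_comm c b, eq_comm]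
  constructor
  · exact fun h j hj => (key j).1 (h _ (FractionalIdeal.mem_coeIdeal_of_mem _ hj))
  · intro h y hy
    obtain ⟨j, hj, rfl⟩ := (FractionalIdeal.mem_coeIdeal _).1 hy
    exact (key j).2 (h j hj)

theorem mem_inv_coeIdeal_iff {J : Ideal R} (hJ : J ≠ ⊥) {u : FractionRing R} :
    u ∈ (J : FractionalIdeal R⁰ (FractionRing R))⁻¹ ↔ ∃ a b : R, b ≠ 0 ∧
      (∀ j ∈ J, b ∣ a * j) ∧
      u = algebraMap R (FractionRing R) a / algebraMap R (FractionRing R) b := by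
  constructor
  · intro hu
    obtain ⟨a, b, hb, rfl⟩ := IsFractionRing.div_surjective (A := R) u
    have hb0 := nonZeroDivisors.ne_zero hb
    exact ⟨a, b, hb0, (div_mem_inv_coeIdeal_iff hJ hb0).1 hu, rfl⟩
  · rintro ⟨a, b, hb, h, rfl⟩
    exact (div_mem_inv_coeIdeal_iff hJ hb).2 h

theorem vClosure_coeIdeal {J : Ideal R} (hJ : J ≠ ⊥) :
    vClosure (J : FractionalIdeal R⁰ (FractionRing R)) = (divClosure J : Ideal R) := by
  have hinj := FaithfulSMul.algebraMap_injective R (FractionRing R)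
  have hone : (1 : FractionRing R) ∈ (J : FractionalIdeal R⁰ (FractionRing R))⁻¹ :=
    (mem_inv_coeIdeal_iff hJ).2 ⟨1, 1, one_ne_zero, by simp, by simp⟩
  have hinv : (J : FractionalIdeal R⁰ (FractionRing R))⁻¹ ≠ 0 := by
    intro h
    rw [h, FractionalIdeal.mem_zero_iff] at hone
    exact one_ne_zero hone
  have key : ∀ {a b x : R}, b ≠ 0 → (algebraMap R (FractionRing R) x *
      (algebraMap R (FractionRing R) a / algebraMap R (FractionRing R) b) ∈
        (1 : FractionalIdeal R⁰ (FractionRing R)) ↔ b ∣ a * x) := by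
    intro a b x hb
    have hb' : algebraMap R (FractionRing R) b ≠ 0 := by simpa using hb
    rw [FractionalIdeal.mem_one_iff]
    refine exists_congr fun c => ?_
    rw [mul_div_assoc', eq_div_iff hb', ← map_mul, ← map_mul, hinj.eq_iff, mul_comm c b,
      mul_comm a x, eq_comm]
  ext x
  rw [vClosure, FractionalIdeal.mem_inv_iff hinv, FractionalIdeal.mem_coeIdeal]
  constructor
  · intro h
    obtain ⟨r, hr⟩ := (FractionalIdeal.mem_one_iff _).1 (h 1 hone)
    rw [mul_one] at hr
    subst hr
    refine ⟨r, fun a b hab => ?_, rfl⟩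
    obtain ⟨j, hj, hj0⟩ := Submodule.exists_mem_ne_zero_of_ne_bot hJ
    -- `divClosure` also tests the pair with `b = 0`; a nonzero element of `J` then forces `a = 0`.
    rcases eq_or_ne b 0 with rfl | hb
    · have ha : a = 0 := by simpa [hj0] using hab j hj
      simp [ha]
    · exact (key hb).1 (h _ ((mem_inv_coeIdeal_iff hJ).2 ⟨a, b, hb, hab, rfl⟩))
  · rintro ⟨r, hr, rfl⟩ y hy
    obtain ⟨a, b, hb, hab, rfl⟩ := (mem_inv_coeIdeal_iff hJ).1 hy
    exact (key hb).2 (hr a b hab)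

omit [IsDomain R] in
theorem divClosure_bot : divClosure (⊥ : Ideal R) = ⊥ := by
  refine eq_bot_iff.2 fun x hx => ?_
  simpa using hx 1 0 (by simp)

theorem tClosure_coeIdeal (I : Ideal R) :
    tClosure (I : FractionalIdeal R⁰ (FractionRing R)) = (tIdealClosure I : Ideal R) := by
  have hinj := FaithfulSMul.algebraMap_injective R (FractionRing R)
  ext x
  rw [mem_tClosure, FractionalIdeal.mem_coeIdeal]
  constructor
  · rintro ⟨J, hJ, hJI, hx⟩
    obtain ⟨J, rfl⟩ :=
      FractionalIdeal.le_one_iff_exists_coeIdeal.1 (hJI.trans FractionalIdeal.coeIdeal_le_one)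
    rcases eq_or_ne J ⊥ with rfl | hJ0
    · rw [FractionalIdeal.coeIdeal_bot, vClosure_zero, FractionalIdeal.mem_zero_iff] at hx
      exact ⟨0, zero_mem _, by simp [hx]⟩
    · rw [vClosure_coeIdeal hJ0, FractionalIdeal.mem_coeIdeal] at hx
      obtain ⟨r, hr, rfl⟩ := hx
      exact ⟨r, ⟨J, (FractionalIdeal.coeIdeal_fg _ hinj J).1 hJ,
        (FractionalIdeal.coeIdeal_le_coeIdeal _).1 hJI, hr⟩, rfl⟩
  · rintro ⟨r, ⟨J, hJ, hJI, hr⟩, rfl⟩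
    refine ⟨J, (FractionalIdeal.coeIdeal_fg _ hinj J).2 hJ,
      (FractionalIdeal.coeIdeal_le_coeIdeal _).2 hJI, ?_⟩
    rcases eq_or_ne J ⊥ with rfl | hJ0
    · rw [divClosure_bot] at hr
      rw [(Submodule.mem_bot R).1 hr, map_zero]
      exact Submodule.zero_mem _
    · rw [vClosure_coeIdeal hJ0]
      exact FractionalIdeal.mem_coeIdeal_of_mem _ hr

theorem isTIdeal_iff_tIdealClosure {I : Ideal R} :
    IsTIdeal I ↔ I ≠ ⊥ ∧ tIdealClosure I = I := by
  rw [IsTIdeal, tClosure_coeIdeal, FractionalIdeal.coeIdeal_inj]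

theorem isTIdeal_iff {I : Ideal R} :
    IsTIdeal I ↔ I ≠ ⊥ ∧ ∀ J : Ideal R, J.FG → J ≤ I → divClosure J ≤ I := by
  rw [isTIdeal_iff_tIdealClosure]
  refine and_congr_right fun _ => ⟨fun h J hJ hJI x hx => ?_, fun h => ?_⟩
  · rw [← h]
    exact ⟨J, hJ, hJI, hx⟩
  · exact le_antisymm (fun x ⟨J, hJ, hJI, hx⟩ => h J hJ hJI hx) (le_tIdealClosure I)

theorem IsTIdeal.divClosure_le {I J : Ideal R} (hI : IsTIdeal I) (hJ : J.FG) (h : J ≤ I) :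
    divClosure J ≤ I :=
  (isTIdeal_iff.1 hI).2 J hJ h

theorem isTIdeal_tIdealClosure {I : Ideal R} (hI : I ≠ ⊥) : IsTIdeal (tIdealClosure I) := by
  refine isTIdeal_iff.2 ⟨ne_bot_of_le_ne_bot hI (le_tIdealClosure I), fun J hJ hJI x hx => ?_⟩
  obtain ⟨L, hL, hLI, hle⟩ := exists_fg_le_divClosure hJ hJI
  refine ⟨L, hL, hLI, ?_⟩
  rw [← divClosure_divClosure]
  exact divClosure_mono hle hx

theorem IsTIdeal.exists_le_isMaximalTIdeal {I : Ideal R} (hI : IsTIdeal I) (hI' : I ≠ ⊤) :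
    ∃ M : Ideal R, I ≤ M ∧ IsMaximalTIdeal M := by
  refine zorn_le_nonempty₀ {I : Ideal R | IsTIdeal I ∧ I ≠ ⊤} ?_ I ⟨hI, hI'⟩
  intro c hc hchain L hL
  have hdir := hchain.directedOn
  refine ⟨sSup c, ⟨isTIdeal_iff.2 ⟨?_, ?_⟩, ?_⟩, fun z hz => le_sSup hz⟩
  · exact ne_bot_of_le_ne_bot (hc hL).1.1 (le_sSup hL)
  · intro J hJ hJc
    obtain ⟨N, hN, hJN⟩ :=
      (CompleteLattice.isCompactElement_iff_le_of_directed_sSup_le _ J).1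
        ((Submodule.fg_iff_compact J).1 hJ) c ⟨L, hL⟩ hdir hJc
    exact ((hc hN).1.divClosure_le hJ hJN).trans (le_sSup hN)
  · rw [Ne, Ideal.eq_top_iff_one, Submodule.mem_sSup_of_directed ⟨L, hL⟩ hdir]
    rintro ⟨N, hN, h1⟩
    exact (hc hN).2 ((Ideal.eq_top_iff_one N).2 h1)

theorem exists_le_isMaximalTIdeal {I : Ideal R} (hI : I ≠ ⊥) (h : (1 : R) ∉ tIdealClosure I) :
    ∃ M : Ideal R, I ≤ M ∧ IsMaximalTIdeal M := by
  obtain ⟨M, hM, hmax⟩ := (isTIdeal_tIdealClosure hI).exists_le_isMaximalTIdeal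
    fun h' => h (h' ▸ Submodule.mem_top)
  exact ⟨M, (le_tIdealClosure I).trans hM, hmax⟩

theorem IsMaximalTIdeal.isTIdeal {M : Ideal R} (hM : IsMaximalTIdeal M) : IsTIdeal M :=
  hM.prop.1

theorem IsMaximalTIdeal.ne_bot {M : Ideal R} (hM : IsMaximalTIdeal M) : M ≠ ⊥ :=
  hM.prop.1.1

theorem IsMaximalTIdeal.one_notMem {M : Ideal R} (hM : IsMaximalTIdeal M) : (1 : R) ∉ M :=
  fun h => hM.prop.2 ((Ideal.eq_top_iff_one M).2 h)

theorem IsMaximalTIdeal.one_notMem_divClosure {M J : Ideal R} (hM : IsMaximalTIdeal M)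
    (hJ : J.FG) (h : J ≤ M) : (1 : R) ∉ divClosure J :=
  fun h1 => hM.one_notMem (hM.isTIdeal.divClosure_le hJ h h1)

theorem IsMaximalTIdeal.eq_of_le {M N : Ideal R} (hM : IsMaximalTIdeal M) (hN : IsTIdeal N)
    (hN' : N ≠ ⊤) (h : M ≤ N) : M = N :=
  Maximal.eq_of_le hM ⟨hN, hN'⟩ h

/-- If `x ∉ M`, maximality gives a finitely generated `J ≤ M + (x)` with `1` in its divisorial
closure. When `xy ∈ M`, the ideal `yJ` lies in `M` and `y` lies in its divisorial closure. -/
theorem IsMaximalTIdeal.isPrime {M : Ideal R} (hM : IsMaximalTIdeal M) : M.IsPrime := by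
  refine ⟨hM.prop.2, fun {x y} hxy => or_iff_not_imp_left.2 fun hx => ?_⟩
  by_cases h1 : (1 : R) ∈ tIdealClosure (M ⊔ Ideal.span {x})
  · obtain ⟨J, hJ, hJM, h1⟩ := h1
    refine hM.isTIdeal.divClosure_le (J := Ideal.span {y} * J)
      (Submodule.FG.mul (Submodule.fg_span_singleton y) hJ) ?_ ?_
    · rw [Ideal.span_singleton_mul_le_iff]
      intro j hj
      obtain ⟨m, hm, z, hz, rfl⟩ := Submodule.mem_sup.1 (hJM hj)
      obtain ⟨c, rfl⟩ := Ideal.mem_span_singleton'.1 hz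
      rw [mul_add, mul_left_comm, mul_comm y x]
      exact add_mem (M.mul_mem_left _ hm) (M.mul_mem_left _ hxy)
    · intro a b hab
      simpa using h1 (a * y) b fun j hj => by
        rw [mul_assoc]
        exact hab _ (Ideal.mul_mem_mul (Ideal.mem_span_singleton_self y) hj)
  · obtain ⟨N, hN, hmax⟩ := exists_le_isMaximalTIdeal
      (ne_bot_of_le_ne_bot hM.ne_bot le_sup_left) h1
    have := hM.eq_of_le hmax.isTIdeal hmax.prop.2 (le_sup_left.trans hN)
    subst this
    exact absurd (hN (le_sup_right (a := M) (Ideal.mem_span_singleton_self x))) hx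

/-- An ideal is `t`-invertible if and only if no maximal `t`-ideal contains its product with its
inverse, the elements of the inverse being written as fractions `a / b`. -/
theorem isTInvertible_iff {A : Ideal R} :
    IsTInvertible A ↔ A ≠ ⊥ ∧ ∀ M : Ideal R, IsMaximalTIdeal M → ∃ a b : R, b ≠ 0 ∧
      (∀ j ∈ A, b ∣ a * j) ∧ ∃ j ∈ A, ∃ c ∉ M, a * j = b * c := by
  have hinj := FaithfulSMul.algebraMap_injective R (FractionRing R)
  refine and_congr_right fun hA => ?_
  -- `A A⁻¹` is an integral ideal `B`, so its `t`-closure can be computed inside `R`.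
  obtain ⟨B, hB⟩ := FractionalIdeal.le_one_iff_exists_coeIdeal.1
    (FractionalIdeal.mul_one_div_le_one (I := (A : FractionalIdeal R⁰ (FractionRing R))))
  rw [← FractionalIdeal.inv_eq] at hB
  have mem_B : ∀ {a b j c : R}, b ≠ 0 → (∀ j ∈ A, b ∣ a * j) → j ∈ A → a * j = b * c → c ∈ B := by
    intro a b j c hb hab hj hc
    have hb' : algebraMap R (FractionRing R) b ≠ 0 := by simpa using hb
    have h := FractionalIdeal.mul_mem_mul (FractionalIdeal.mem_coeIdeal_of_mem R⁰ hj)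
      ((div_mem_inv_coeIdeal_iff hA hb).2 hab)
    rw [← hB, mul_div_assoc', ← map_mul, mul_comm j a, hc, map_mul,
      mul_div_cancel_left₀ _ hb', FractionalIdeal.mem_coeIdeal] at h
    obtain ⟨c', hc', h⟩ := h
    rwa [← hinj h]
  have hB0 : B ≠ ⊥ := by
    obtain ⟨j, hj, hj0⟩ := Submodule.exists_mem_ne_zero_of_ne_bot hA
    have hjB : j ∈ B := mem_B one_ne_zero (a := 1) (by simp) hj rfl
    rintro rfl
    exact hj0 hjB
  rw [← hB, tClosure_coeIdeal, ← FractionalIdeal.coeIdeal_top, FractionalIdeal.coeIdeal_inj,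
    Ideal.eq_top_iff_one]
  constructor
  · rintro ⟨J, hJ, hJB, h1⟩ M hM
    by_contra! hcon
    refine hM.one_notMem_divClosure hJ (hJB.trans ?_) h1
    rw [← FractionalIdeal.coeIdeal_le_coeIdeal (FractionRing R), hB, FractionalIdeal.mul_le]
    intro x hx u hu
    obtain ⟨j, hj, rfl⟩ := (FractionalIdeal.mem_coeIdeal _).1 hx
    obtain ⟨a, b, hb, hab, rfl⟩ := (mem_inv_coeIdeal_iff hA).1 hu
    have hb' : algebraMap R (FractionRing R) b ≠ 0 := by simpa using hb
    obtain ⟨c, hc⟩ := hab j hj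
    rw [mul_div_assoc', ← map_mul, mul_comm j a, hc, map_mul, mul_div_cancel_left₀ _ hb']
    refine FractionalIdeal.mem_coeIdeal_of_mem _ ?_
    by_contra hcM
    exact hcon a b hb hab j hj c hcM hc
  · intro h
    by_contra h1
    obtain ⟨M, hBM, hM⟩ := exists_le_isMaximalTIdeal hB0 h1
    obtain ⟨a, b, hb, hab, j, hj, c, hcM, hc⟩ := h M hM
    exact hcM (hBM (mem_B hb hab hj hc))

/-- For an ideal `A` it suffices to test `t`-invertibility at the maximal `t`-ideals
containing `A`. -/
theorem isTInvertible_of_forall_le {A : Ideal R} (hA : A ≠ ⊥)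
    (h : ∀ M : Ideal R, IsMaximalTIdeal M → A ≤ M → ∃ a b : R, b ≠ 0 ∧
      (∀ j ∈ A, b ∣ a * j) ∧ ∃ j ∈ A, ∃ c ∉ M, a * j = b * c) : IsTInvertible A := by
  refine isTInvertible_iff.2 ⟨hA, fun M hM => ?_⟩
  by_cases hAM : A ≤ M
  · exact h M hM hAM
  · obtain ⟨j, hj, hjM⟩ := SetLike.not_le_iff_exists.1 hAM
    exact ⟨1, 1, one_ne_zero, by simp, j, hj, j, hjM, rfl⟩

end Domain

/-! ### Coefficient ideals and contents -/

section CoeffIdeal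

variable {R : Type*} [CommRing R]

/-- The ideal generated by the coefficients of the members of an ideal of `R[X]`. -/
noncomputable def coeffIdeal (A : Ideal R[X]) : Ideal R :=
  ⨆ f ∈ A, contentIdeal f

theorem contentIdeal_le_iff {f : R[X]} {I : Ideal R} : f.contentIdeal ≤ I ↔ ∀ n, f.coeff n ∈ I := by
  refine ⟨fun h n => h (f.coeff_mem_contentIdeal n), fun h => ?_⟩
  rw [contentIdeal_def, Ideal.span_le]
  intro r hr
  obtain ⟨n, _, rfl⟩ := mem_coeffs_iff.1 (Finset.mem_coe.1 hr)
  exact h n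

theorem coeffIdeal_le_iff {A : Ideal R[X]} {I : Ideal R} : coeffIdeal A ≤ I ↔ A ≤ I.map C := by
  simp only [coeffIdeal, iSup_le_iff, contentIdeal_le_iff]
  exact forall₂_congr fun f _ => Ideal.mem_map_C_iff.symm

theorem coeff_mem_coeffIdeal {A : Ideal R[X]} {f : R[X]} (hf : f ∈ A) (n : ℕ) :
    f.coeff n ∈ coeffIdeal A :=
  Ideal.mem_map_C_iff.1 (coeffIdeal_le_iff.1 le_rfl hf) n

theorem coeffIdeal_span (s : Set R[X]) : coeffIdeal (Ideal.span s) = ⨆ f ∈ s, contentIdeal f := by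
  refine eq_of_forall_ge_iff fun I => ?_
  rw [coeffIdeal_le_iff, Ideal.span_le]
  simp only [iSup_le_iff, contentIdeal_le_iff]
  exact forall₂_congr fun f _ => Ideal.mem_map_C_iff

theorem fg_coeffIdeal {A : Ideal R[X]} (hA : A.FG) : (coeffIdeal A).FG := by
  obtain ⟨s, rfl⟩ := hA
  rw [coeffIdeal_span]
  exact Submodule.fg_biSup s _ fun f _ => f.contentIdeal_FG

theorem coeffIdeal_ne_bot {A : Ideal R[X]} (hA : A ≠ ⊥) : coeffIdeal A ≠ ⊥ := by
  intro h
  refine hA (eq_bot_iff.2 ?_)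
  simpa [Ideal.map_bot] using coeffIdeal_le_iff.1 h.le

theorem map_C_ne_bot {I : Ideal R} (hI : I ≠ ⊥) : I.map (C : R →+* R[X]) ≠ ⊥ := by
  rwa [Ne, Ideal.map_eq_bot_iff_of_injective C_injective]

theorem map_C_le_map_C_iff {I J : Ideal R} :
    I.map (C : R →+* R[X]) ≤ J.map (C : R →+* R[X]) ↔ I ≤ J := by
  refine ⟨fun h r hr => ?_, Ideal.map_mono⟩
  simpa using Ideal.mem_map_C_iff.1 (h (Ideal.mem_map_of_mem C hr)) 0

/-- Shifting `g` past the degree of `f` keeps the coefficients of the two from overlapping. Contents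
of members of `A` are thus directed, so a finitely generated part of `coeffIdeal A` lies in a single
content. -/
theorem exists_contentIdeal_sup_le {A : Ideal R[X]} {f g : R[X]} (hf : f ∈ A) (hg : g ∈ A) :
    ∃ h ∈ A, f.contentIdeal ⊔ g.contentIdeal ≤ h.contentIdeal := by
  have hmem := coeff_mem_contentIdeal (f + g * X ^ (f.natDegree + 1))
  have hcf : f.contentIdeal ≤ (f + g * X ^ (f.natDegree + 1)).contentIdeal := by
    refine contentIdeal_le_iff.2 fun n => ?_
    rcases le_or_gt n f.natDegree with hn | hn
    · have := hmem n
      rwa [coeff_add, coeff_mul_X_pow', if_neg (by omega), add_zero] at this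
    · rw [coeff_eq_zero_of_natDegree_lt hn]
      exact zero_mem _
  refine ⟨f + g * X ^ (f.natDegree + 1), add_mem hf (A.mul_mem_right _ hg), sup_le hcf ?_⟩
  refine contentIdeal_le_iff.2 fun n => ?_
  have := hmem (n + (f.natDegree + 1))
  rwa [coeff_add, coeff_mul_X_pow,
    Ideal.add_mem_iff_right _ (hcf (f.coeff_mem_contentIdeal _))] at this

theorem exists_le_contentIdeal {A : Ideal R[X]} {J : Ideal R} (hJ : J.FG)
    (h : J ≤ coeffIdeal A) : ∃ g ∈ A, J ≤ g.contentIdeal := by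
  have hdir : DirectedOn (· ≤ ·) (contentIdeal '' (A : Set R[X])) := by
    rintro _ ⟨f, hf, rfl⟩ _ ⟨g, hg, rfl⟩
    obtain ⟨k, hk, hle⟩ := exists_contentIdeal_sup_le hf hg
    exact ⟨_, ⟨k, hk, rfl⟩, le_sup_left.trans hle, le_sup_right.trans hle⟩
  obtain ⟨_, ⟨g, hg, rfl⟩, hle⟩ :=
    (CompleteLattice.isCompactElement_iff_le_of_directed_sSup_le _ J).1
      ((Submodule.fg_iff_compact J).1 hJ) (contentIdeal '' (A : Set R[X]))
        ⟨_, 0, A.zero_mem, rfl⟩ hdir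
      (by rwa [sSup_image])
  exact ⟨g, hg, hle⟩

/-- Testing against constant fractions `C a / C b` alone suffices. -/
theorem divClosure_le_map_C (A : Ideal R[X]) :
    divClosure A ≤ (divClosure (coeffIdeal A)).map C := by
  refine fun f hf => Ideal.mem_map_C_iff.2 fun n a b hab => ?_
  have h : C b ∣ C a * f := hf (C a) (C b) fun g hg =>
    (C_dvd_iff_dvd_coeff _ _).2 fun n => by
      rw [coeff_C_mul]
      exact hab _ (coeff_mem_coeffIdeal hg n)
  simpa using (C_dvd_iff_dvd_coeff _ _).1 h n

/-- McCoy's theorem over `R/(b)`: if `g` were a zero divisor there, a nonzero constant `a` would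
kill it. Then `b` divides `a` times the content of `g`, hence `b ∣ a` by `hg`, a contradiction. -/
theorem C_dvd_of_C_dvd_mul {g h : R[X]} {b : R} (hg : (1 : R) ∈ divClosure g.contentIdeal)
    (hb : C b ∣ h * g) : C b ∣ h := by
  have C_dvd_iff : ∀ p : R[X], C b ∣ p ↔ p.map (Ideal.Quotient.mk (Ideal.span {b})) = 0 := by
    intro p
    rw [C_dvd_iff_dvd_coeff, Polynomial.ext_iff]
    simp [Ideal.Quotient.eq_zero_iff_mem, Ideal.mem_span_singleton]
  rw [C_dvd_iff] at hb ⊢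
  rw [Polynomial.map_mul] at hb
  by_contra hne
  have hdiv : g.map (Ideal.Quotient.mk (Ideal.span {b})) ∉ (R ⧸ Ideal.span {b})[X]⁰ := fun hreg =>
    hne (mul_right_mem_nonZeroDivisors_eq_zero_iff hreg |>.1 hb)
  obtain ⟨s, hs, hsg⟩ := Polynomial.notMem_nonZeroDivisors_iff.1 hdiv
  obtain ⟨a, rfl⟩ := Ideal.Quotient.mk_surjective s
  have hcoef : ∀ n, b ∣ a * g.coeff n := by
    intro n
    have := congrArg (fun p => p.coeff n) hsg
    simpa [← map_mul, Ideal.Quotient.eq_zero_iff_mem, Ideal.mem_span_singleton] using this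
  refine hs (Ideal.Quotient.eq_zero_iff_mem.2 (Ideal.mem_span_singleton.2 ?_))
  have hle : g.contentIdeal ≤ Submodule.comap (LinearMap.mulLeft R a) (Ideal.span {b}) :=
    contentIdeal_le_iff.2 fun n => Ideal.mem_span_singleton.2 (hcoef n)
  simpa using hg a b fun j hj => Ideal.mem_span_singleton.1 (hle hj)

end CoeffIdeal

/-! ### Maximal `t`-ideals of `R[X]` -/

section Polynomial

variable {R : Type*} [CommRing R] [IsDomain R]

theorem IsTIdeal.map_C {I : Ideal R} (hI : IsTIdeal I) : IsTIdeal (I.map (C : R →+* R[X])) := by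
  refine isTIdeal_iff.2 ⟨map_C_ne_bot hI.1, fun A hA hAI => (divClosure_le_map_C A).trans ?_⟩
  exact Ideal.map_mono (hI.divClosure_le (fg_coeffIdeal hA) (coeffIdeal_le_iff.2 hAI))

theorem IsMaximalTIdeal.map_C_ne_top {M : Ideal R} (hM : IsMaximalTIdeal M) :
    M.map (C : R →+* R[X]) ≠ ⊤ := by
  intro h
  have := Ideal.mem_map_C_iff.1 (h ▸ Submodule.mem_top : (1 : R[X]) ∈ M.map C) 0
  exact hM.one_notMem (by simpa using this)

/-- The dichotomy is whether the `t`-closure of `coeffIdeal Q` is all of `R`. -/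
theorem IsMaximalTIdeal.exists_eq_map_C_or {Q : Ideal R[X]} (hQ : IsMaximalTIdeal Q) :
    (∃ M : Ideal R, IsMaximalTIdeal M ∧ Q = M.map C) ∨
      ∃ g ∈ Q, (1 : R) ∈ divClosure g.contentIdeal := by
  by_cases h : (1 : R) ∈ tIdealClosure (coeffIdeal Q)
  · obtain ⟨J, hJ, hJQ, h1⟩ := h
    obtain ⟨g, hg, hle⟩ := exists_le_contentIdeal hJ hJQ
    exact Or.inr ⟨g, hg, divClosure_mono hle h1⟩
  · obtain ⟨M, hle, hM⟩ := exists_le_isMaximalTIdeal (coeffIdeal_ne_bot hQ.ne_bot) h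
    exact Or.inl ⟨M, hM, hQ.eq_of_le hM.isTIdeal.map_C hM.map_C_ne_top (coeffIdeal_le_iff.1 hle)⟩

/-- If `a / b` carries `C d` to `u` and `g` to `w`, then `u g = C d w`, so `C d ∣ u` and `a / b = u
/ C d` is a polynomial. -/
theorem one_mem_divClosure_span_pair {d : R} (hd : d ≠ 0) {g : R[X]}
    (hg : (1 : R) ∈ divClosure g.contentIdeal) :
    (1 : R[X]) ∈ divClosure (Ideal.span {C d, g}) := by
  intro a b hab
  rw [mul_one]
  obtain ⟨u, hu⟩ := hab (C d) (Ideal.subset_span (by simp))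
  obtain ⟨w, hw⟩ := hab g (Ideal.subset_span (by simp))
  rcases eq_or_ne b 0 with rfl | hb
  · have : a = 0 := by simpa [hd] using hu
    simp [this]
  · have hdu : C d ∣ u := by
      refine C_dvd_of_C_dvd_mul hg ⟨w, mul_left_cancel₀ hb ?_⟩
      rw [← mul_assoc, ← hu, mul_left_comm, ← hw]
      ring
    obtain ⟨v, rfl⟩ := hdu
    refine ⟨v, mul_right_cancel₀ (C_ne_zero.2 hd) ?_⟩
    rw [hu]
    ring

theorem IsMaximalTIdeal.exists_eq_map_C {Q : Ideal R[X]} (hQ : IsMaximalTIdeal Q) {d : R}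
    (hd : d ≠ 0) (hdQ : C d ∈ Q) : ∃ M : Ideal R, IsMaximalTIdeal M ∧ Q = M.map C := by
  refine hQ.exists_eq_map_C_or.resolve_right ?_
  rintro ⟨g, hg, h1⟩
  refine hQ.one_notMem_divClosure (Submodule.fg_span (Set.toFinite _)) ?_
    (one_mem_divClosure_span_pair hd h1)
  rw [Ideal.span_le]
  rintro x (rfl | rfl) <;> assumption

theorem IsMaximalTIdeal.exists_C_mem_map_C {M : Ideal R} (hM : IsMaximalTIdeal M) :
    ∃ d : R, d ≠ 0 ∧ C d ∈ M.map (C : R →+* R[X]) := by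
  obtain ⟨d, hd, hd0⟩ := Submodule.exists_mem_ne_zero_of_ne_bot hM.ne_bot
  exact ⟨d, hd0, Ideal.mem_map_of_mem C hd⟩

/-- A maximal `t`-ideal above `M[X]` contains a nonzero constant, hence is some `N[X]` with `M ≤ N`.
-/
theorem IsMaximalTIdeal.map_C {M : Ideal R} (hM : IsMaximalTIdeal M) :
    IsMaximalTIdeal (M.map (C : R →+* R[X])) := by
  obtain ⟨Q, hle, hQ⟩ := hM.isTIdeal.map_C.exists_le_isMaximalTIdeal hM.map_C_ne_top
  obtain ⟨d, hd, hdM⟩ := hM.exists_C_mem_map_C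
  obtain ⟨N, hN, rfl⟩ := IsMaximalTIdeal.exists_eq_map_C hQ hd (hle hdM)
  rwa [hM.eq_of_le hN.isTIdeal hN.prop.2 (map_C_le_map_C_iff.1 hle)]

/-- Pseudo-division by an element of minimal degree of an ideal of `R[X]`. -/
theorem exists_dvd_C_mul {Q : Ideal R[X]} {f : R[X]} (hf : f ∈ Q) (hf0 : f ≠ 0)
    (hmin : ∀ h ∈ Q, h ≠ 0 → f.natDegree ≤ h.natDegree) {h : R[X]} (hh : h ∈ Q) :
    ∃ d : R, d ≠ 0 ∧ f ∣ C d * h := by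
  induction hn : h.natDegree using Nat.strong_induction_on generalizing h with
  | _ n ih =>
    rcases eq_or_ne h 0 with rfl | hh0
    · exact ⟨1, one_ne_zero, by simp⟩
    have hdeg := hmin h hh hh0
    have hlc : f.leadingCoeff ≠ 0 := leadingCoeff_ne_zero.2 hf0
    have hk : C f.leadingCoeff * h - C h.leadingCoeff * X ^ (h.natDegree - f.natDegree) * f ∈ Q :=
      sub_mem (Q.mul_mem_left _ hh) (Q.mul_mem_left _ hf)
    rcases eq_or_ne (C f.leadingCoeff * h -
      C h.leadingCoeff * X ^ (h.natDegree - f.natDegree) * f) 0 with hk0 | hk0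
    · exact ⟨_, hlc, by rw [sub_eq_zero.1 hk0]; exact dvd_mul_left _ _⟩
    have hlt : (C f.leadingCoeff * h -
        C h.leadingCoeff * X ^ (h.natDegree - f.natDegree) * f).natDegree < n := by
      subst hn
      have hlch : h.leadingCoeff ≠ 0 := leadingCoeff_ne_zero.2 hh0
      have hlch' : C f.leadingCoeff * h ≠ 0 := mul_ne_zero (C_ne_zero.2 hlc) hh0
      have hd : (C f.leadingCoeff * h).natDegree = h.natDegree := natDegree_C_mul hlc
      refine (natDegree_lt_natDegree hk0 (degree_sub_lt_left ?_ hlch' ?_)).trans_eq hd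
      · rw [degree_mul, degree_C hlc, zero_add, degree_mul, degree_C_mul_X_pow _ hlch,
          degree_eq_natDegree hh0, degree_eq_natDegree hf0, ← Nat.cast_add,
          Nat.sub_add_cancel hdeg]
      · rw [leadingCoeff_mul, leadingCoeff_C, leadingCoeff_mul, leadingCoeff_C_mul_X_pow, mul_comm]
    obtain ⟨d, hd, hdvd⟩ := ih _ hlt hk rfl
    refine ⟨d * f.leadingCoeff, mul_ne_zero hd hlc, ?_⟩
    rw [mul_sub, dvd_sub_left ((dvd_mul_left _ _).mul_left _)] at hdvd
    rwa [C_mul, mul_assoc]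

theorem exists_dvd_C_mul_of_fg {Q : Ideal R[X]} {f : R[X]}
    (hdvd : ∀ h ∈ Q, ∃ d : R, d ≠ 0 ∧ f ∣ C d * h) {A : Ideal R[X]} (hA : A.FG) (hAQ : A ≤ Q) :
    ∃ d : R, d ≠ 0 ∧ ∀ h ∈ A, f ∣ C d * h := by
  classical
  obtain ⟨s, rfl⟩ := hA
  rw [Ideal.span_le] at hAQ
  choose! d hd0 hd using hdvd
  refine ⟨∏ h ∈ s, d h, Finset.prod_ne_zero_iff.2 fun h hh => hd0 h (hAQ hh), ?_⟩
  have hle : Ideal.span (s : Set R[X]) ≤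
      Submodule.comap (LinearMap.mulLeft R[X] (C (∏ h ∈ s, d h))) (Ideal.span {f}) := by
    refine Ideal.span_le.2 fun h hh => Ideal.mem_span_singleton.2 ?_
    refine (hd h (hAQ hh)).trans (mul_dvd_mul_right (map_dvd C ?_) h)
    exact Finset.dvd_prod_of_mem d (Finset.mem_coe.1 hh)
  exact fun h hh => Ideal.mem_span_singleton.1 (hle hh)

/-- A maximal `t`-ideal of `R[X]` containing a polynomial of unit content up to divisorial closure
contains a `t`-super rigid ideal. -/
theorem IsMaximalTIdeal.exists_isTSuperRigid {Q : Ideal R[X]} (hQ : IsMaximalTIdeal Q) {g : R[X]}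
    (hgQ : g ∈ Q) (hg : (1 : R) ∈ divClosure g.contentIdeal) :
    ∃ A : Ideal R[X], IsTSuperRigid A ∧ A ≤ Q := by
  -- With a nonzero constant, `N` would be some `M[X]`, putting the content of `g` inside `M`.
  have not_C_mem : ∀ {N : Ideal R[X]}, IsMaximalTIdeal N → g ∈ N → ∀ d : R, d ≠ 0 → C d ∉ N := by
    intro N hN hgN d hd hdN
    obtain ⟨M, hM, rfl⟩ := hN.exists_eq_map_C hd hdN
    exact hM.one_notMem_divClosure g.contentIdeal_FG
      (contentIdeal_le_iff.2 (Ideal.mem_map_C_iff.1 hgN)) hg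
  obtain ⟨f, ⟨hfQ, hf0⟩, hmin⟩ := (measure (natDegree (R := R))).wf.has_min {h | h ∈ Q ∧ h ≠ 0}
    (Submodule.exists_mem_ne_zero_of_ne_bot hQ.ne_bot)
  replace hmin : ∀ h ∈ Q, h ≠ 0 → f.natDegree ≤ h.natDegree := fun h hh hh0 =>
    not_lt.1 (hmin h ⟨hh, hh0⟩)
  have hpair : ∀ {N : Ideal R[X]}, Ideal.span {f, g} ≤ N ↔ f ∈ N ∧ g ∈ N := by
    intro N
    rw [Ideal.span_le, Set.insert_subset_iff, Set.singleton_subset_iff]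
    rfl
  have hdvd : ∀ h ∈ Q, ∃ d : R, d ≠ 0 ∧ f ∣ C d * h := fun h hh =>
    exists_dvd_C_mul hfQ hf0 hmin hh
  have huniq : ∀ N : Ideal R[X], IsMaximalTIdeal N → Ideal.span {f, g} ≤ N → N = Q := by
    intro N hN hle
    obtain ⟨hfN, hgN⟩ := hpair.1 hle
    refine (hQ.eq_of_le hN.isTIdeal hN.prop.2 fun h hh => ?_).symm
    obtain ⟨d, hd, hdh⟩ := hdvd h hh
    exact (hN.isPrime.mem_or_mem (N.mem_of_dvd hdh hfN)).resolve_left (not_C_mem hN hgN d hd)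
  have hne : Ideal.span {f, g} ≠ ⊥ := fun h => hf0 (by simpa using (hpair.1 h.le).1)
  refine ⟨Ideal.span {f, g}, ⟨⟨hne, Submodule.fg_span (Set.toFinite _), Q,
    ⟨hQ, hpair.2 ⟨hfQ, hgQ⟩⟩,
    fun N hN => huniq N hN.1 hN.2⟩, fun A hA hle => ?_⟩, hpair.2 ⟨hfQ, hgQ⟩⟩
  refine isTInvertible_of_forall_le (ne_bot_of_le_ne_bot hne hle) fun N hN hAN => ?_
  obtain rfl := huniq N hN (hle.trans hAN)
  obtain ⟨d, hd, hdA⟩ := exists_dvd_C_mul_of_fg hdvd hA hAN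
  -- The fraction `d / f` lies in `A⁻¹`, and multiplying it by `f ∈ A` gives `d ∉ Q`.
  exact ⟨C d, f, hf0, hdA, f, (hpair.1 hle).1, C d, not_C_mem hN hgQ d hd, mul_comm _ _⟩

/-! ### Transfer of rigidity and super rigidity -/

theorem IsTRigid.map_C {I : Ideal R} (hI : IsTRigid I) : IsTRigid (I.map (C : R →+* R[X])) := by
  obtain ⟨hI0, hfg, M, ⟨hM, hIM⟩, huniq⟩ := hI
  refine ⟨map_C_ne_bot hI0, hfg.map C, M.map C, ⟨hM.map_C, Ideal.map_mono hIM⟩, ?_⟩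
  rintro Q ⟨hQ, hIQ⟩
  obtain ⟨d, hd, hd0⟩ := Submodule.exists_mem_ne_zero_of_ne_bot hI0
  obtain ⟨N, hN, rfl⟩ := hQ.exists_eq_map_C hd0 (hIQ (Ideal.mem_map_of_mem C hd))
  rw [huniq N ⟨hN, map_C_le_map_C_iff.1 hIQ⟩]

theorem IsTRigid.coeffIdeal {A : Ideal R[X]} (hA : IsTRigid A) {M : Ideal R}
    (hM : IsMaximalTIdeal M) (hle : A ≤ M.map C) : IsTRigid (coeffIdeal A) := by
  obtain ⟨hA0, hfg, Q, -, huniq⟩ := hA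
  refine ⟨coeffIdeal_ne_bot hA0, fg_coeffIdeal hfg, M, ⟨hM, coeffIdeal_le_iff.2 hle⟩, ?_⟩
  rintro N ⟨hN, hAN⟩
  have h : N.map C = M.map C := (huniq _ ⟨hN.map_C, coeffIdeal_le_iff.1 hAN⟩).trans
    (huniq _ ⟨hM.map_C, hle⟩).symm
  exact le_antisymm (map_C_le_map_C_iff.1 h.le) (map_C_le_map_C_iff.1 h.ge)

/-- The fraction `a / b` that works for `coeffIdeal A` at `M` also works for `A`: if it carried `A`
into `M[X]`, it would carry every coefficient into `M`. -/
theorem IsTInvertible.of_coeffIdeal {A : Ideal R[X]} (hA : IsTInvertible (TOperation.coeffIdeal A))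
    {M : Ideal R} (hM : IsMaximalTIdeal M) : ∃ a b : R[X], b ≠ 0 ∧
      (∀ f ∈ A, b ∣ a * f) ∧ ∃ f ∈ A, ∃ c ∉ M.map C, a * f = b * c := by
  obtain ⟨a, b, hb, hab, j, hj, c, hc, hjc⟩ := (isTInvertible_iff.1 hA).2 M hM
  have hdvd : ∀ f ∈ A, C b ∣ C a * f := fun f hf => (C_dvd_iff_dvd_coeff _ _).2 fun n => by
    rw [coeff_C_mul]
    exact hab _ (coeff_mem_coeffIdeal hf n)
  refine ⟨C a, C b, C_ne_zero.2 hb, hdvd, ?_⟩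
  by_contra! hcon
  have hle : TOperation.coeffIdeal A ≤
      Submodule.comap (LinearMap.mulLeft R a) (Ideal.span {b} * M) := by
    refine iSup₂_le fun f hf => contentIdeal_le_iff.2 fun n => ?_
    obtain ⟨k, hk⟩ := hdvd f hf
    have hkM : k ∈ M.map C := by
      by_contra hkM
      exact hcon f hf k hkM hk
    refine Ideal.mem_span_singleton_mul.2 ⟨k.coeff n, Ideal.mem_map_C_iff.1 hkM n, ?_⟩
    simpa using (congrArg (fun p => p.coeff n) hk).symm
  obtain ⟨m, hm, hmj⟩ := Ideal.mem_span_singleton_mul.1 (hle hj)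
  have : b * m = b * c := hmj.trans hjc
  exact hc (mul_left_cancel₀ hb this ▸ hm)

/-- For a nonzero `i ∈ J`, the fraction `a / b` equals `w / i` with `w` a polynomial. Each `w.coeff
n / i` then lies in `J⁻¹`, and if all of them carried `J` into `M`, `a / b` would carry `J[X]` into
`M[X]`. -/
theorem IsTInvertible.exists_of_map_C {J : Ideal R}
    (hJ : IsTInvertible (J.map (C : R →+* R[X]))) {M : Ideal R} (hM : IsMaximalTIdeal M) :
    ∃ a b : R, b ≠ 0 ∧ (∀ j ∈ J, b ∣ a * j) ∧ ∃ j ∈ J, ∃ c ∉ M, a * j = b * c := by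
  obtain ⟨a, b, hb, hab, f, hf, c, hc, hfc⟩ := (isTInvertible_iff.1 hJ).2 _ hM.map_C
  obtain ⟨i, hi, hi0⟩ := Submodule.exists_mem_ne_zero_of_ne_bot
    (fun h => hJ.1 (by rw [h, Ideal.map_bot]) : J ≠ ⊥)
  obtain ⟨w, hw⟩ := hab (C i) (Ideal.mem_map_of_mem C hi)
  have key : ∀ {p q : R[X]}, a * p = b * q → w * p = C i * q := by
    intro p q h
    refine mul_left_cancel₀ hb ?_
    rw [← mul_assoc, ← hw, mul_right_comm, h]
    ring
  have hdvd : ∀ n, ∀ j ∈ J, i ∣ w.coeff n * j := by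
    intro n j hj
    obtain ⟨q, hq⟩ := hab (C j) (Ideal.mem_map_of_mem C hj)
    exact ⟨q.coeff n, by simpa using congrArg (fun p => p.coeff n) (key hq)⟩
  by_contra! hcon
  have hmem : ∀ n, ∀ j ∈ J, w.coeff n * j ∈ Ideal.span {i} * M := by
    intro n j hj
    obtain ⟨q, hq⟩ := hdvd n j hj
    refine Ideal.mem_span_singleton_mul.2 ⟨q, ?_, hq.symm⟩
    by_contra hqM
    exact hcon _ i hi0 (hdvd n) j hj q hqM hq
  refine hc (Ideal.mem_map_C_iff.2 fun n => ?_)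
  have hn : i * c.coeff n ∈ Ideal.span {i} * M := by
    rw [← coeff_C_mul, ← key hfc, coeff_mul]
    exact sum_mem fun x _ => hmem _ _ (Ideal.mem_map_C_iff.1 hf _)
  obtain ⟨m, hm, hmc⟩ := Ideal.mem_span_singleton_mul.1 hn
  rwa [← mul_left_cancel₀ hi0 hmc]

theorem IsTSuperRigid.map_C {I : Ideal R} (hI : IsTSuperRigid I) :
    IsTSuperRigid (I.map (C : R →+* R[X])) := by
  refine ⟨hI.1.map_C, fun A hA hle => ?_⟩
  have hIA : I ≤ TOperation.coeffIdeal A :=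
    map_C_le_map_C_iff.1 (hle.trans (coeffIdeal_le_iff.1 le_rfl))
  have hinv := hI.2 _ (fg_coeffIdeal hA) hIA
  refine isTInvertible_of_forall_le (ne_bot_of_le_ne_bot hI.1.map_C.1 hle) fun Q hQ hAQ => ?_
  obtain ⟨d, hd, hd0⟩ := Submodule.exists_mem_ne_zero_of_ne_bot hI.1.1
  -- Since `A` contains a nonzero constant, only extended maximal `t`-ideals need testing.
  obtain ⟨M, hM, rfl⟩ := hQ.exists_eq_map_C hd0 (hAQ (hle (Ideal.mem_map_of_mem C hd)))
  exact hinv.of_coeffIdeal hM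

theorem IsTSuperRigid.coeffIdeal {A : Ideal R[X]} (hA : IsTSuperRigid A) {M : Ideal R}
    (hM : IsMaximalTIdeal M) (hle : A ≤ M.map C) : IsTSuperRigid (coeffIdeal A) := by
  refine ⟨hA.1.coeffIdeal hM hle, fun J hJ hAJ => isTInvertible_iff.2
    ⟨ne_bot_of_le_ne_bot (coeffIdeal_ne_bot hA.1.1) hAJ, fun N hN => ?_⟩⟩
  exact (hA.2 _ (hJ.map C) (coeffIdeal_le_iff.1 hAJ)).exists_of_map_C hN

theorem isTPotent_polynomial_iff : IsTPotent R[X] ↔ IsTPotent R := by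
  constructor
  · intro h M hM
    obtain ⟨A, hA, hle⟩ := h _ hM.map_C
    exact ⟨_, hA.coeffIdeal hM hle, coeffIdeal_le_iff.2 hle⟩
  · intro h Q hQ
    rcases hQ.exists_eq_map_C_or with ⟨M, hM, rfl⟩ | ⟨g, hgQ, hg⟩
    · obtain ⟨I, hI, hle⟩ := h M hM
      exact ⟨_, hI.map_C, Ideal.map_mono hle⟩
    · obtain ⟨A, hA, hle⟩ := hQ.exists_isTSuperRigid hgQ hg
      exact ⟨A, hA.1, hle⟩

theorem isTSuperPotent_polynomial_iff : IsTSuperPotent R[X] ↔ IsTSuperPotent R := by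
  constructor
  · intro h M hM
    obtain ⟨A, hA, hle⟩ := h _ hM.map_C
    exact ⟨_, hA.coeffIdeal hM hle, coeffIdeal_le_iff.2 hle⟩
  · intro h Q hQ
    rcases hQ.exists_eq_map_C_or with ⟨M, hM, rfl⟩ | ⟨g, hgQ, hg⟩
    · obtain ⟨I, hI, hle⟩ := h M hM
      exact ⟨_, hI.map_C, Ideal.map_mono hle⟩
    · exact hQ.exists_isTSuperRigid hgQ hg

end Polynomial

end TOperation

theorem theorem3p2 (R : Type*) [CommRing R] [IsDomain R] :
    (TOperation.IsTPotent R ↔ TOperation.IsTPotent (Polynomial R)) ∧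
    (TOperation.IsTSuperPotent R ↔ TOperation.IsTSuperPotent (Polynomial R)) :=
  ⟨TOperation.isTPotent_polynomial_iff.symm, TOperation.isTSuperPotent_polynomial_iff.symm⟩
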